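/- Setting. Let $Y_t=\varphi_t^{\top}\theta^*+W_t$, $t=1,2,\dots$, with deterministic regressors $\varphi_t\in\mathbb R^d$ ($d\ge 1$), true parameter $\theta^*\in\mathbb R^d$ and noise $W_t$. Let $\Phi_n$ be the $n\times d$ matrix with rows $\varphi_1^{\top},\dots,\varphi_n^{\top}$ and $\bar R_n=\frac1n\Phi_n^{\top}\Phi_n$. Assume: (A1) the $W_t$ are independent, nonatomic, symmetric about zero and $\sigma$-subgaussian, i.e. $\mathbb E\,e^{\lambda W_t}\le e^{\lambda^2\sigma^2/2}$ for all $\lambda\in\mathbb R$; (A2) any $d$ of the regressors span $\mathbb R^d$; (A3) $\lambda_{\min}(\bar R_n)\ge\lambda_0>0$ for all $n\ge d$; (A4) $\mu(\Phi_n)=\frac nd\max_{1\le i\le n}\|\Phi_{Q,n}^{\top}e_i\|^2\le\kappa\,n^{1-\rho}$ for all $n\ge d$, where $\Phi_n=\Phi_{Q,n}\Phi_{R,n}$ is the thin QR decomposition, $\kappa>0$ and $0<\rho\le1$. SPS confidence region. Let $m>q>0$ be integers and $p=1-q/m$. Let $\alpha_{i,t}$ ($1\le i\le m-1$, $1\le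 t\le n$) be i.i.d. random signs, uniform on $\{1,-1\}$, and let $\pi$ be a uniform random permutation of $\{0,\dots,m-1\}$; the noise, the signs and $\pi$ are independent. Put $S_0(\theta)=\bar R_n^{-1/2}\frac1n\sum_{t=1}^n\varphi_t(Y_t-\varphi_t^{\top}\theta)$ and $S_i(\theta)=\bar R_n^{-1/2}\frac1n\sum_{t=1}^n\alpha_{i,t}\varphi_t(Y_t-\varphi_t^{\top}\theta)$. The $p$-level SPS confidence region $\widehat\Theta_{p,n}$ is the set of all $\theta\in\mathbb R^d$ for which the rank $1+\#\{1\le i\le m-1:\ \|S_0(\theta)\|^2\succ_\pi\|S_i(\theta)\|^2\}$ is at most $m-q$, where $\|S_k\|^2\succ_\pi\|S_j\|^2$ means that $\|S_k\|^2>\|S_j\|^2$, or that $\|S_k\|^2=\|S_j\|^2$ and $\pi(k)>\pi(j)$. Corollary 1. With high probability, the diameters of the SPS confidence regions shrink at the rate $\mathcal O(1/\sqrt n)$, whatever the coherence parameters $\kappa$ and $\rho$. Precisely: for all $d$, $m>q>0$ and $\delta>0$ there is a constant $c>0$, depending only on $d,m,q,\delta$, such that for all $\kappa>0$ and $0<\rho\le1$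 there is an $N$, depending only on $d,m,q,\delta,\kappa,\rho$, such that for every $\sigma$, every $\lambda_0>0$, every system satisfying (A1)–(A4) and every $n\ge N$, $$\sup_{\theta_1,\theta_2\in\widehat\Theta_{p,n}}\|\theta_1-\theta_2\|\ \le\ \frac{c\,\sigma}{\sqrt{\lambda_0}}\cdot\frac1{\sqrt n}$$ with probability at least $1-\delta$ (the supremum is $+\infty$ for an unbounded region). -/

import Mathlib

open MeasureTheory ProbabilityTheory
open scoped NNReal ENNReal Matrix

noncomputable section

namespace SPS

/-! ### Regression data -/

/-- The regressor matrix `Φ_n`, with rows `φ_tᵀ`, `t < n`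
(the sample is indexed by `0, …, n - 1` instead of `1, …, n`). -/
def regMatrix {d : ℕ} (φ : ℕ → EuclideanSpace ℝ (Fin d)) (n : ℕ) :
    Matrix (Fin n) (Fin d) ℝ :=
  Matrix.of fun t j => φ t j

/-- `R̄_n = (1/n) Φ_nᵀ Φ_n = (1/n) ∑_t φ_t φ_tᵀ`. -/
def Rbar {d : ℕ} (φ : ℕ → EuclideanSpace ℝ (Fin d)) (n : ℕ) : Matrix (Fin d) (Fin d) ℝ :=
  (1 / (n : ℝ)) • ((regMatrix φ n)ᵀ * regMatrix φ n)

theorem Rbar_isHermitian {d : ℕ} (φ : ℕ → EuclideanSpace ℝ (Fin d)) (n : ℕ) :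
    (Rbar φ n).IsHermitian := by
  simp [Matrix.IsHermitian, Rbar, Matrix.conjTranspose_eq_transpose_of_trivial]

/-- The smallest eigenvalue of a real symmetric matrix. -/
def lambdaMin {d : ℕ} {A : Matrix (Fin d) (Fin d) ℝ} (hA : A.IsHermitian) : ℝ :=
  ⨅ i, hA.eigenvalues i

/-- The inverse of the principal square root of a real symmetric matrix: the function
`x ↦ 1/√x` applied to it in an orthonormal eigenbasis. -/
def invSqrt {d : ℕ} {A : Matrix (Fin d) (Fin d) ℝ} (hA : A.IsHermitian) :
    Matrix (Fin d) (Fin d) ℝ :=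
  hA.cfc fun x => (√x)⁻¹

/-- If `A` is positive definite, `A^{-1/2}` is the positive semidefinite matrix whose square is
`A⁻¹`. -/
theorem invSqrt_spec {d : ℕ} {A : Matrix (Fin d) (Fin d) ℝ} (hA : A.IsHermitian)
    (h : A.PosDef) : (invSqrt hA).PosSemidef ∧ invSqrt hA * invSqrt hA = A⁻¹ := by
  have key : ∀ f : ℝ → ℝ, hA.cfc f = (hA.eigenvectorUnitary : Matrix (Fin d) (Fin d) ℝ) *
      Matrix.diagonal (fun i => f (hA.eigenvalues i)) *
      (hA.eigenvectorUnitary : Matrix (Fin d) (Fin d) ℝ)ᴴ := fun f => rfl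
  have hspec : A = (hA.eigenvectorUnitary : Matrix (Fin d) (Fin d) ℝ) *
      Matrix.diagonal hA.eigenvalues *
      (hA.eigenvectorUnitary : Matrix (Fin d) (Fin d) ℝ)ᴴ := hA.spectral_theorem
  have hpos : ∀ i, 0 < hA.eigenvalues i := fun i => h.eigenvalues_pos i
  have hU : (hA.eigenvectorUnitary : Matrix (Fin d) (Fin d) ℝ)ᴴ *
      (hA.eigenvectorUnitary : Matrix (Fin d) (Fin d) ℝ) = 1 :=
    Unitary.coe_star_mul_self hA.eigenvectorUnitary
  have hU' : (hA.eigenvectorUnitary : Matrix (Fin d) (Fin d) ℝ) *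
      (hA.eigenvectorUnitary : Matrix (Fin d) (Fin d) ℝ)ᴴ = 1 :=
    Unitary.coe_mul_star_self hA.eigenvectorUnitary
  rw [invSqrt, key]
  generalize (hA.eigenvectorUnitary : Matrix (Fin d) (Fin d) ℝ) = U at *
  generalize hA.eigenvalues = e at *
  constructor
  · refine Matrix.PosSemidef.mul_mul_conjTranspose_same (Matrix.PosSemidef.diagonal fun i => ?_) U
    simp
  · symm
    apply Matrix.inv_eq_left_inv
    have hD : Matrix.diagonal (fun i => (√(e i))⁻¹) * Matrix.diagonal (fun i => (√(e i))⁻¹) *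
        Matrix.diagonal e = (1 : Matrix (Fin d) (Fin d) ℝ) := by
      rw [Matrix.diagonal_mul_diagonal, Matrix.diagonal_mul_diagonal, ← Matrix.diagonal_one]
      congr 1
      funext i
      rw [← mul_inv, Real.mul_self_sqrt (hpos i).le, inv_mul_cancel₀ (hpos i).ne']
    rw [hspec]
    generalize Matrix.diagonal (fun i => (√(e i))⁻¹) = D at *
    calc U * D * Uᴴ * (U * D * Uᴴ) * (U * Matrix.diagonal e * Uᴴ)
        = U * D * (Uᴴ * U) * D * (Uᴴ * U) * Matrix.diagonal e * Uᴴ := by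
          simp only [Matrix.mul_assoc]
      _ = U * (D * D * Matrix.diagonal e) * Uᴴ := by
          simp only [hU, Matrix.mul_assoc, Matrix.one_mul]
      _ = 1 := by rw [hD, Matrix.mul_one, hU']

/-! ### Thin QR decomposition and coherence -/

/-- The `Q`-factor of the thin QR decomposition: its columns are the Gram–Schmidt
orthonormalization of the columns of `Φ`. -/
def thinQ {n d : ℕ} (Φ : Matrix (Fin n) (Fin d) ℝ) : Matrix (Fin n) (Fin d) ℝ :=
  Matrix.of fun t j =>
    InnerProductSpace.gramSchmidtNormed ℝ (fun k => WithLp.toLp 2 (Φ.col k)) j t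

/-- The `R`-factor of the thin QR decomposition. -/
def thinR {n d : ℕ} (Φ : Matrix (Fin n) (Fin d) ℝ) : Matrix (Fin d) (Fin d) ℝ :=
  (thinQ Φ)ᵀ * Φ

/-- For `Φ` of full column rank, `thinQ Φ` and `thinR Φ` form the thin QR decomposition:
`Φ = Q R`, `Q` has orthonormal columns, `R` is upper triangular with positive diagonal. -/
theorem thinQR_spec {n d : ℕ} (Φ : Matrix (Fin n) (Fin d) ℝ) (h : LinearIndependent ℝ Φ.col) :
    thinQ Φ * thinR Φ = Φ ∧ (thinQ Φ)ᵀ * thinQ Φ = 1 ∧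
      (∀ i j, j < i → thinR Φ i j = 0) ∧ ∀ i, 0 < thinR Φ i i := by
  set f : Fin d → EuclideanSpace ℝ (Fin n) := fun k => WithLp.toLp 2 (Φ.col k) with hf
  have hli : LinearIndependent ℝ f :=
    h.map' (WithLp.linearEquiv 2 ℝ (Fin n → ℝ)).symm.toLinearMap (LinearEquiv.ker _)
  have ho := InnerProductSpace.gramSchmidtNormed_orthonormal (𝕜 := ℝ) hli
  set g := InnerProductSpace.gramSchmidtNormed ℝ f with hg
  have hR : ∀ i j, thinR Φ i j = inner ℝ (g i) (f j) := by
    intro i j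
    simp [thinR, thinQ, Matrix.mul_apply, PiLp.inner_apply, hf, hg, mul_comm]
  refine ⟨?_, ?_, ?_, ?_⟩
  · have hmem : ∀ j, f j ∈ Submodule.span ℝ (Set.range g) := by
      intro j
      rw [hg, InnerProductSpace.span_gramSchmidtNormed_range, InnerProductSpace.span_gramSchmidt]
      exact Submodule.subset_span ⟨j, rfl⟩
    ext t j
    obtain ⟨c, hc⟩ := (Submodule.mem_span_range_iff_exists_fun ℝ).1 (hmem j)
    have hcoef : ∀ k, inner ℝ (g k) (f j) = c k := by
      intro k
      rw [← hc]
      exact ho.inner_right_fintype c k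
    have h1 : (f j) t = Φ t j := rfl
    rw [← h1, ← hc]
    simp [Matrix.mul_apply, hR, hcoef, thinQ, ← hf, ← hg, mul_comm]
  · ext i j
    have := orthonormal_iff_ite.1 ho i j
    rw [Matrix.one_apply, ← this]
    simp [thinQ, Matrix.mul_apply, PiLp.inner_apply, hf, hg, mul_comm]
  · intro i j hij
    rw [hR, hg, InnerProductSpace.gramSchmidtNormed, inner_smul_left,
      InnerProductSpace.gramSchmidt_inv_triangular ℝ f hij, mul_zero]
  · intro i
    have hne := InnerProductSpace.gramSchmidt_ne_zero i hli
    have hself : inner ℝ (InnerProductSpace.gramSchmidt ℝ f i) (f i)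
        = ‖InnerProductSpace.gramSchmidt ℝ f i‖ ^ 2 := by
      conv_lhs => rw [InnerProductSpace.gramSchmidt_def'' ℝ f i]
      rw [inner_add_right, inner_sum, real_inner_self_eq_norm_sq,
        Finset.sum_eq_zero, add_zero]
      intro k hk
      rw [inner_smul_right, InnerProductSpace.gramSchmidt_orthogonal ℝ f
        (Finset.mem_Iio.1 hk).ne', mul_zero]
    rw [hR, hg, InnerProductSpace.gramSchmidtNormed, inner_smul_left, hself]
    have := norm_pos_iff.2 hne
    simp only [conj_trivial, RCLike.ofReal_real_eq_id, id_eq]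
    positivity

/-- The coherence `μ(Φ) = (n/d) max_i ‖Φ_Qᵀ e_i‖²` of an `n × d` matrix. -/
def coherence {n d : ℕ} (Φ : Matrix (Fin n) (Fin d) ℝ) : ℝ :=
  (n / d : ℝ) *
    ⨆ i : Fin n, ‖WithLp.toLp 2 ((thinQ Φ)ᵀ *ᵥ (Pi.single i (1 : ℝ) : Fin n → ℝ))‖ ^ 2

/-! ### Assumptions -/

/-- The noise is an independent sequence of nonatomic `σ`-subgaussian random variables with
distributions symmetric about zero (`HasSubgaussianMGF X (σ ^ 2)` says that
`𝔼 exp (t X) ≤ exp (σ² t² / 2)` for all real `t`, the left-hand side being finite). -/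
structure NoiseAssumption {Ω : Type*} [MeasurableSpace Ω] (P : Measure Ω) (W : ℕ → Ω → ℝ)
    (σ : ℝ≥0) : Prop where
  measurable : ∀ t, Measurable (W t)
  indep : iIndepFun W P
  nonatomic : ∀ t (w : ℝ), P {ω | W t ω = w} = 0
  subgaussian : ∀ t, HasSubgaussianMGF (W t) (σ ^ 2) P
  symmetric : ∀ t, P.map (fun ω => -W t ω) = P.map (W t)

/-- Complete excitation: any `d` regressors span the whole space. -/
def CompletelyExciting {d : ℕ} (φ : ℕ → EuclideanSpace ℝ (Fin d)) : Prop :=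
  ∀ T : Finset ℕ, T.card = d → Submodule.span ℝ (φ '' (T : Set ℕ)) = ⊤

/-- Nonvanishing excitation with constant `lam0`. -/
def NonvanishingExcitation {d : ℕ} (φ : ℕ → EuclideanSpace ℝ (Fin d)) (lam0 : ℝ) : Prop :=
  ∀ n : ℕ, d ≤ n → lam0 ≤ lambdaMin (Rbar_isHermitian φ n)

/-- Coherence bound with parameters `κ` and `ρ`. -/
def CoherenceBound {d : ℕ} (φ : ℕ → EuclideanSpace ℝ (Fin d)) (κ ρ : ℝ) : Prop :=
  ∀ n : ℕ, d ≤ n → coherence (regMatrix φ n) ≤ κ * (n : ℝ) ^ (1 - ρ)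

/-! ### The Sign-Perturbed Sums algorithm -/

/-- The outputs `Y_t = φ_tᵀ θ* + W_t`. -/
def output {d : ℕ} (φ : ℕ → EuclideanSpace ℝ (Fin d)) (θs : EuclideanSpace ℝ (Fin d))
    (w : ℕ → ℝ) (t : ℕ) : ℝ :=
  inner ℝ (φ t) θs + w t

/-- The prediction error `ε_t(θ) = Y_t - φ_tᵀ θ`. -/
def predError {d : ℕ} (φ : ℕ → EuclideanSpace ℝ (Fin d)) (y : ℕ → ℝ)
    (θ : EuclideanSpace ℝ (Fin d)) (t : ℕ) : ℝ :=
  y t - inner ℝ (φ t) θ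

/-- The sum `R̄_n^{-1/2} (1/n) ∑_t a_t φ_t ε_t(θ)` for signs `a`. -/
def signSum {d : ℕ} (φ : ℕ → EuclideanSpace ℝ (Fin d)) (y : ℕ → ℝ) (n : ℕ) (a : Fin n → ℝ)
    (θ : EuclideanSpace ℝ (Fin d)) : EuclideanSpace ℝ (Fin d) :=
  WithLp.toLp 2 (invSqrt (Rbar_isHermitian φ n) *ᵥ
    WithLp.ofLp ((1 / (n : ℝ)) • ∑ t : Fin n, (a t * predError φ y θ t) • φ t))

/-- The sums `S_0(θ)` (unperturbed) and `S_i(θ)`, `i = 1, …, m - 1` (perturbed with the signs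
`a i`). -/
def S {d m n : ℕ} [NeZero m] (φ : ℕ → EuclideanSpace ℝ (Fin d)) (y : ℕ → ℝ)
    (a : {i : Fin m // i ≠ 0} → Fin n → ℝ) (i : Fin m) (θ : EuclideanSpace ℝ (Fin d)) :
    EuclideanSpace ℝ (Fin d) :=
  if h : i = 0 then signSum φ y n (fun _ => 1) θ else signSum φ y n (a ⟨i, h⟩) θ

/-- `‖S_k(θ)‖² ≻_π ‖S_j(θ)‖²`: strictly greater, ties being broken by the permutation `π`. -/
def TieGT {d m n : ℕ} [NeZero m] (φ : ℕ → EuclideanSpace ℝ (Fin d)) (y : ℕ → ℝ)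
    (a : {i : Fin m // i ≠ 0} → Fin n → ℝ) (π : Equiv.Perm (Fin m))
    (θ : EuclideanSpace ℝ (Fin d)) (k j : Fin m) : Prop :=
  ‖S φ y a k θ‖ ^ 2 > ‖S φ y a j θ‖ ^ 2 ∨
    (‖S φ y a k θ‖ ^ 2 = ‖S φ y a j θ‖ ^ 2 ∧ π k > π j)

open Classical in
/-- The rank of `‖S_0(θ)‖²` among the `‖S_i(θ)‖²`. -/
def rank {d m n : ℕ} [NeZero m] (φ : ℕ → EuclideanSpace ℝ (Fin d)) (y : ℕ → ℝ)
    (a : {i : Fin m // i ≠ 0} → Fin n → ℝ) (π : Equiv.Perm (Fin m))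
    (θ : EuclideanSpace ℝ (Fin d)) : ℕ :=
  1 + ∑ i : {i : Fin m // i ≠ 0}, if TieGT φ y a π θ 0 i then 1 else 0

/-- The SPS-Indicator function. -/
def indicator {d m n : ℕ} [NeZero m] (q : ℕ) (φ : ℕ → EuclideanSpace ℝ (Fin d)) (y : ℕ → ℝ)
    (a : {i : Fin m // i ≠ 0} → Fin n → ℝ) (π : Equiv.Perm (Fin m))
    (θ : EuclideanSpace ℝ (Fin d)) : ℕ :=
  if rank φ y a π θ ≤ m - q then 1 else 0

/-- The SPS confidence region (of level `1 - q/m`). -/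
def confRegion {d m n : ℕ} [NeZero m] (q : ℕ) (φ : ℕ → EuclideanSpace ℝ (Fin d)) (y : ℕ → ℝ)
    (a : {i : Fin m // i ≠ 0} → Fin n → ℝ) (π : Equiv.Perm (Fin m)) :
    Set (EuclideanSpace ℝ (Fin d)) :=
  {θ | indicator q φ y a π θ = 1}

/-- The randomization of the algorithm: the `n (m - 1)` signs are i.i.d. and uniform on `{1, -1}`,
`π` is a uniformly distributed permutation, and the noise, the signs and `π` are mutually
independent. -/
structure Randomization {Ω : Type*} [MeasurableSpace Ω] (P : Measure Ω) (W : ℕ → Ω → ℝ)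
    {m n : ℕ} [NeZero m] (α : {i : Fin m // i ≠ 0} → Fin n → Ω → ℝ)
    (π : Ω → Equiv.Perm (Fin m)) : Prop where
  measurable_sign : ∀ i t, Measurable (α i t)
  sign_pos : ∀ i t, P {ω | α i t ω = 1} = 1 / 2
  sign_neg : ∀ i t, P {ω | α i t ω = -1} = 1 / 2
  indep_sign : iIndepFun (fun p : {i : Fin m // i ≠ 0} × Fin n => α p.1 p.2) P
  measurable_perm : ∀ s, MeasurableSet {ω | π ω = s}
  uniform_perm : ∀ s, P {ω | π ω = s} = 1 / (m.factorial : ℝ≥0∞)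
  indep : iIndep ![⨆ t, MeasurableSpace.comap (W t) inferInstance,
    ⨆ i, ⨆ t, MeasurableSpace.comap (α i t) inferInstance,
    MeasurableSpace.comap π ⊤] P

end SPS

end

/-!
Write `V = n^{-1/2} Φ R̄^{-1/2}`, so that `VᵀV = 1`, and put the error `θ* - θ` in the coordinates
`u = n^{1/2} R̄^{1/2} (θ* - θ)`, for which `|u|² ≥ n λ₀ |θ* - θ|²`. The sums of the algorithm become
`n^{1/2} S₀ = u + VᵀW` and `n^{1/2} Sᵢ = (VᵀDᵢV) u + VᵀDᵢW`, where `Dᵢ` is the diagonal matrix of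
the `i`-th row of signs (`sqrt_smul_signSum`). Since `q ≥ 1`, a parameter `θ` of the confidence
region satisfies `|S₀(θ)| ≤ |Sᵢ(θ)|` for some `i ≠ 0`. If `VᵀDᵢV` has Frobenius norm at most `1/2`,
this gives `|u| ≤ 2 (|VᵀW| + |VᵀDᵢW|)` (`norm_sub_sq_le_of_mem_confRegion`).

Everything then follows from second moments. The noise is centred with variance at most
`4 σ²`, so `|VᵀW|²` and `|VᵀDᵢW|²` have means at most `4 d σ²`. The signs are orthonormal in `L²`,
so the mean
square of the Frobenius norm of `VᵀDᵢV` is at most the sum of the fourth powers of the row norms of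
`V`. The rows of `V` have the same norms as the rows of the `Q`-factor, because both matrices have
the same projection `V Vᵀ = Q Qᵀ` (`whitened_mul_transpose`); hence that sum is at most
`d² κ n^{-ρ}`, which tends to zero. So the coherence parameters enter only through how large `n` has
to be, and not through the constant. One application of Markov's inequality to a weighted sum of
these quantities concludes (`measure_lt_ediam_confRegion_le`).
-/

namespace SPS

/-! ### Whitened regressors -/

/-- The whitened regressor matrix `n^{-1/2} Φ_n R̄_n^{-1/2}`. When `R̄_n` is positive definite, its
columns are an orthonormal basis of the column space of `Φ_n`. -/
noncomputable def whitened {d : ℕ} (φ : ℕ → EuclideanSpace ℝ (Fin d)) (n : ℕ) :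
    Matrix (Fin n) (Fin d) ℝ :=
  (√(n : ℝ))⁻¹ • (regMatrix φ n * invSqrt (Rbar_isHermitian φ n))

section Deterministic

variable {d n : ℕ} {φ : ℕ → EuclideanSpace ℝ (Fin d)}

theorem le_eigenvalues_of_le_lambdaMin {A : Matrix (Fin d) (Fin d) ℝ} (hA : A.IsHermitian)
    {l : ℝ} (h : l ≤ lambdaMin hA) (i : Fin d) : l ≤ hA.eigenvalues i :=
  h.trans (ciInf_le (Set.finite_range _).bddBelow i)

theorem posDef_of_lambdaMin_pos {A : Matrix (Fin d) (Fin d) ℝ} (hA : A.IsHermitian)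
    (h : 0 < lambdaMin hA) : A.PosDef :=
  hA.posDef_iff_eigenvalues_pos.2 fun i =>
    h.trans_le (le_eigenvalues_of_le_lambdaMin hA le_rfl i)

theorem lambdaMin_mul_dotProduct_le {A : Matrix (Fin d) (Fin d) ℝ} (hA : A.IsHermitian)
    {l : ℝ} (h : l ≤ lambdaMin hA) (x : Fin d → ℝ) : l * (x ⬝ᵥ x) ≤ x ⬝ᵥ (A *ᵥ x) := by
  have hspec : A = (hA.eigenvectorUnitary : Matrix (Fin d) (Fin d) ℝ) *
      Matrix.diagonal hA.eigenvalues *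
      (hA.eigenvectorUnitary : Matrix (Fin d) (Fin d) ℝ)ᴴ := hA.spectral_theorem
  have hU' : (hA.eigenvectorUnitary : Matrix (Fin d) (Fin d) ℝ) *
      (hA.eigenvectorUnitary : Matrix (Fin d) (Fin d) ℝ)ᴴ = 1 :=
    Unitary.coe_mul_star_self hA.eigenvectorUnitary
  have he := le_eigenvalues_of_le_lambdaMin hA h
  generalize (hA.eigenvectorUnitary : Matrix (Fin d) (Fin d) ℝ) = U at *
  generalize hA.eigenvalues = e at *
  rw [Matrix.conjTranspose_eq_transpose_of_trivial] at *
  have h1 : x ⬝ᵥ (A *ᵥ x) = (Uᵀ *ᵥ x) ⬝ᵥ (Matrix.diagonal e *ᵥ (Uᵀ *ᵥ x)) := by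
    rw [hspec, ← Matrix.mulVec_mulVec, ← Matrix.mulVec_mulVec, Matrix.dotProduct_mulVec,
      ← Matrix.mulVec_transpose]
  have h2 : x ⬝ᵥ x = (Uᵀ *ᵥ x) ⬝ᵥ (Uᵀ *ᵥ x) := by
    nth_rewrite 2 [← Matrix.one_mulVec x]
    rw [← hU', ← Matrix.mulVec_mulVec, Matrix.dotProduct_mulVec, ← Matrix.mulVec_transpose]
  rw [h1, h2, dotProduct, dotProduct, Finset.mul_sum]
  refine Finset.sum_le_sum fun i _ => ?_
  rw [Matrix.mulVec_diagonal]
  nlinarith [he i, mul_self_nonneg ((Uᵀ *ᵥ x) i)]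

theorem invSqrt_transpose {A : Matrix (Fin d) (Fin d) ℝ} (hA : A.IsHermitian) (h : A.PosDef) :
    (invSqrt hA)ᵀ = invSqrt hA := by
  rw [← Matrix.conjTranspose_eq_transpose_of_trivial]
  exact (invSqrt_spec hA h).1.isHermitian

theorem invSqrt_mul_mul_invSqrt {A : Matrix (Fin d) (Fin d) ℝ} (hA : A.IsHermitian)
    (h : A.PosDef) : invSqrt hA * A * invSqrt hA = 1 := by
  rw [mul_eq_one_comm, ← mul_assoc, (invSqrt_spec hA h).2,
    Matrix.nonsing_inv_mul _ ((Matrix.isUnit_iff_isUnit_det A).1 h.isUnit)]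

theorem transpose_mul_regMatrix (hn : 0 < n) :
    (regMatrix φ n)ᵀ * regMatrix φ n = (n : ℝ) • Rbar φ n := by
  rw [Rbar, smul_smul, mul_one_div_cancel (by positivity), one_smul]

theorem transpose_mul_whitened (hn : 0 < n) (h : (Rbar φ n).PosDef) :
    (whitened φ n)ᵀ * whitened φ n = 1 := by
  have hs : (√(n : ℝ))⁻¹ * (√(n : ℝ))⁻¹ * n = 1 := by
    rw [← mul_inv, Real.mul_self_sqrt (by positivity), inv_mul_cancel₀ (by positivity)]
  rw [whitened, Matrix.transpose_smul, Matrix.transpose_mul, invSqrt_transpose _ h,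
    Matrix.smul_mul, Matrix.mul_smul, smul_smul, Matrix.mul_assoc,
    ← Matrix.mul_assoc (regMatrix φ n)ᵀ, transpose_mul_regMatrix hn, Matrix.smul_mul,
    Matrix.mul_smul, smul_smul, hs, one_smul, ← Matrix.mul_assoc, invSqrt_mul_mul_invSqrt _ h]

theorem linearIndependent_col_regMatrix (hn : 0 < n) (h : (Rbar φ n).PosDef) :
    LinearIndependent ℝ (regMatrix φ n).col := by
  rw [← Matrix.mulVec_injective_iff]
  refine Function.Injective.of_comp (f := fun x => (regMatrix φ n)ᵀ *ᵥ x) ?_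
  have hu : IsUnit ((regMatrix φ n)ᵀ * regMatrix φ n) := by
    rw [transpose_mul_regMatrix hn]
    exact h.isUnit.smul (Units.mk0 (n : ℝ) (by positivity))
  have := Matrix.mulVec_injective_of_isUnit hu
  simpa only [Function.comp_def, Matrix.mulVec_mulVec] using this

/-- The whitened regressors and the `Q`-factor are orthonormal bases of the same space, so they
have the same projection matrix and hence the same row norms (the leverage scores). -/
theorem whitened_mul_transpose (hn : 0 < n) (h : (Rbar φ n).PosDef) :
    whitened φ n * (whitened φ n)ᵀ = thinQ (regMatrix φ n) * (thinQ (regMatrix φ n))ᵀ := by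
  obtain ⟨hQR, hQ, -, -⟩ := thinQR_spec _ (linearIndependent_col_regMatrix hn h)
  set Q := thinQ (regMatrix φ n)
  set M := (√(n : ℝ))⁻¹ • (thinR (regMatrix φ n) * invSqrt (Rbar_isHermitian φ n))
  have hV : whitened φ n = Q * M := by
    rw [whitened, ← hQR, Matrix.mul_assoc, Matrix.mul_smul]
  have hM : Mᵀ * M = 1 := by
    have := transpose_mul_whitened hn h
    rwa [hV, Matrix.transpose_mul, Matrix.mul_assoc, ← Matrix.mul_assoc Qᵀ, hQ,
      Matrix.one_mul] at this
  rw [hV, Matrix.transpose_mul, Matrix.mul_assoc, ← Matrix.mul_assoc M,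
    mul_eq_one_comm.1 hM, Matrix.one_mul]

theorem sum_sq_whitened_le (hd : 0 < d) (hn : 0 < n) (h : (Rbar φ n).PosDef) {κ ρ : ℝ}
    (hc : coherence (regMatrix φ n) ≤ κ * (n : ℝ) ^ (1 - ρ)) (t : Fin n) :
    ∑ j, whitened φ n t j ^ 2 ≤ d * κ * (n : ℝ) ^ (-ρ) := by
  have hn' : (0 : ℝ) < n := by exact_mod_cast hn
  have hd' : (0 : ℝ) < d := by exact_mod_cast hd
  have h1 : ∑ j, whitened φ n t j ^ 2 = ∑ j, thinQ (regMatrix φ n) t j ^ 2 := by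
    have := congrFun (congrFun (whitened_mul_transpose hn h) t) t
    simpa only [Matrix.mul_apply, Matrix.transpose_apply, ← pow_two] using this
  have h2 : ‖WithLp.toLp 2 ((thinQ (regMatrix φ n))ᵀ *ᵥ (Pi.single t (1 : ℝ) : Fin n → ℝ))‖ ^ 2
      = ∑ j, thinQ (regMatrix φ n) t j ^ 2 := by
    rw [EuclideanSpace.real_norm_sq_eq]
    simp
  have h3 : ∑ j, thinQ (regMatrix φ n) t j ^ 2 ≤
      ⨆ i : Fin n, ‖WithLp.toLp 2
        ((thinQ (regMatrix φ n))ᵀ *ᵥ (Pi.single i (1 : ℝ) : Fin n → ℝ))‖ ^ 2 := by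
    rw [← h2]
    exact le_ciSup (f := fun i : Fin n => ‖WithLp.toLp 2
      ((thinQ (regMatrix φ n))ᵀ *ᵥ (Pi.single i (1 : ℝ) : Fin n → ℝ))‖ ^ 2)
      (Set.finite_range _).bddAbove t
  have h4 : (n : ℝ) ^ (1 - ρ) = n * (n : ℝ) ^ (-ρ) := by
    rw [sub_eq_add_neg, Real.rpow_add hn', Real.rpow_one]
  rw [coherence, h4] at hc
  rw [h1]
  refine h3.trans ?_
  generalize (⨆ i : Fin n, ‖WithLp.toLp 2
    ((thinQ (regMatrix φ n))ᵀ *ᵥ (Pi.single i (1 : ℝ) : Fin n → ℝ))‖ ^ 2) = s at *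
  rw [div_mul_eq_mul_div, div_le_iff₀ hd'] at hc
  refine le_of_mul_le_mul_left ?_ hn'
  linarith

theorem sum_sum_sq_whitened (hn : 0 < n) (h : (Rbar φ n).PosDef) :
    ∑ j, ∑ t, whitened φ n t j ^ 2 = d := by
  have h1 : ∀ j, ∑ t, whitened φ n t j ^ 2 = 1 := fun j => by
    have := congrFun (congrFun (transpose_mul_whitened hn h) j) j
    simpa only [Matrix.mul_apply, Matrix.transpose_apply, ← pow_two, Matrix.one_apply_eq]
      using this
  simp [h1]

/-! ### Deterministic geometry of the confidence region -/

/-- The matrix `Vᵀ diag(a) V`. Its entries are written as sums linear in `a`, so that second moment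
bounds apply to each of them. -/
noncomputable def signedGram (V : Matrix (Fin n) (Fin d) ℝ) (a : Fin n → ℝ) :
    Matrix (Fin d) (Fin d) ℝ :=
  Matrix.of fun j k => ∑ t, a t * (V t j * V t k)

theorem signedGram_one {V : Matrix (Fin n) (Fin d) ℝ} (hV : Vᵀ * V = 1) :
    signedGram V (fun _ => 1) = 1 := by
  rw [← hV]
  ext j k
  simp [signedGram, Matrix.mul_apply]

/-- The whitened coordinates `u = n^{1/2} R̄^{1/2} x` of a parameter error `x`, in the form
`n^{1/2} R̄^{-1/2} R̄ x`. -/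
noncomputable def whitenedError (φ : ℕ → EuclideanSpace ℝ (Fin d)) (n : ℕ) (x : Fin d → ℝ) :
    Fin d → ℝ :=
  √(n : ℝ) • (invSqrt (Rbar_isHermitian φ n) *ᵥ (Rbar φ n *ᵥ x))

theorem whitened_mulVec_whitenedError (hn : 0 < n) (h : (Rbar φ n).PosDef) (x : Fin d → ℝ) :
    whitened φ n *ᵥ whitenedError φ n x = regMatrix φ n *ᵥ x := by
  have hs : (√(n : ℝ))⁻¹ * √(n : ℝ) = 1 := inv_mul_cancel₀ (by positivity)
  rw [whitened, whitenedError, Matrix.mulVec_smul, Matrix.smul_mulVec, smul_smul,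
    mul_comm, hs, one_smul, Matrix.mulVec_mulVec, Matrix.mulVec_mulVec, Matrix.mul_assoc,
    Matrix.mul_assoc, ← Matrix.mul_assoc (invSqrt _), (invSqrt_spec _ h).2,
    Matrix.nonsing_inv_mul _ ((Matrix.isUnit_iff_isUnit_det _).1 h.isUnit), Matrix.mul_one]

theorem mul_dotProduct_le_whitenedError (hn : 0 < n) (h : (Rbar φ n).PosDef) {l : ℝ}
    (hl : l ≤ lambdaMin (Rbar_isHermitian φ n)) (x : Fin d → ℝ) :
    n * l * (x ⬝ᵥ x) ≤ whitenedError φ n x ⬝ᵥ whitenedError φ n x := by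
  have hn' : (0 : ℝ) < n := by exact_mod_cast hn
  -- `V u = Φ x` with `VᵀV = 1` and `ΦᵀΦ = n R̄`, so that `|u|² = |Φ x|² = n xᵀ R̄ x`.
  have key : whitenedError φ n x ⬝ᵥ whitenedError φ n x = n * (x ⬝ᵥ (Rbar φ n *ᵥ x)) := by
    have iso : ∀ (A : Matrix (Fin n) (Fin d) ℝ) (z : Fin d → ℝ),
        (A *ᵥ z) ⬝ᵥ (A *ᵥ z) = z ⬝ᵥ ((Aᵀ * A) *ᵥ z) := fun A z => by
      rw [← Matrix.mulVec_mulVec, Matrix.dotProduct_mulVec z, ← Matrix.mulVec_transpose,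
        Matrix.transpose_transpose]
    calc whitenedError φ n x ⬝ᵥ whitenedError φ n x
        = (whitened φ n *ᵥ whitenedError φ n x) ⬝ᵥ (whitened φ n *ᵥ whitenedError φ n x) := by
          rw [iso, transpose_mul_whitened hn h, Matrix.one_mulVec]
      _ = n * (x ⬝ᵥ (Rbar φ n *ᵥ x)) := by
          rw [whitened_mulVec_whitenedError hn h, iso, transpose_mul_regMatrix hn,
            Matrix.smul_mulVec, dotProduct_smul, smul_eq_mul]
  rw [key, mul_assoc]
  exact mul_le_mul_of_nonneg_left (lambdaMin_mul_dotProduct_le _ hl x) hn'.le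

/-- In whitened coordinates the sums of the algorithm read `n^{1/2} S = Vᵀ D V u + Vᵀ D w`. -/
theorem sqrt_smul_signSum (hn : 0 < n) (h : (Rbar φ n).PosDef)
    (θs θ : EuclideanSpace ℝ (Fin d)) (w : ℕ → ℝ) (a : Fin n → ℝ) :
    √(n : ℝ) • signSum φ (output φ θs w) n a θ = WithLp.toLp 2
      (signedGram (whitened φ n) a *ᵥ whitenedError φ n (WithLp.ofLp (θs - θ))) +
      WithLp.toLp 2 ((whitened φ n)ᵀ *ᵥ fun t => a t * w t) := by
  have hp : ∀ t : Fin n, predError φ (output φ θs w) θ t =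
      (whitened φ n *ᵥ whitenedError φ n (WithLp.ofLp (θs - θ))) t + w t := fun t => by
    rw [whitened_mulVec_whitenedError hn h, predError, output, add_sub_right_comm,
      ← inner_sub_right]
    congr 1
    simp [PiLp.inner_apply, Matrix.mulVec, dotProduct, regMatrix, mul_comm]
  have hs : √(n : ℝ) * (1 / n) = (√(n : ℝ))⁻¹ := by
    have : (0 : ℝ) < n := by exact_mod_cast hn
    rw [mul_one_div, Real.sqrt_div_self]
  have h1 : WithLp.ofLp (∑ t : Fin n, (a t * predError φ (output φ θs w) θ t) • φ t) =
      (regMatrix φ n)ᵀ *ᵥ fun t => a t * predError φ (output φ θs w) θ t := by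
    ext j
    simp [Matrix.mulVec, dotProduct, regMatrix, mul_comm]
  have h2 : √(n : ℝ) • signSum φ (output φ θs w) n a θ =
      WithLp.toLp 2 ((whitened φ n)ᵀ *ᵥ fun t => a t * predError φ (output φ θs w) θ t) := by
    rw [signSum, WithLp.ofLp_smul, h1, Matrix.mulVec_smul, WithLp.toLp_smul, smul_smul, hs,
      whitened, Matrix.transpose_smul, Matrix.transpose_mul, invSqrt_transpose _ h,
      Matrix.smul_mulVec, WithLp.toLp_smul, Matrix.mulVec_mulVec]
  rw [h2, ← WithLp.toLp_add]
  congr 1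
  have h3 : (fun t : Fin n => a t * predError φ (output φ θs w) θ t) =
      (Matrix.diagonal a *ᵥ
        (whitened φ n *ᵥ whitenedError φ n (WithLp.ofLp (θs - θ)))) + fun t => a t * w t := by
    ext t
    rw [hp t, Pi.add_apply, Matrix.mulVec_diagonal, mul_add]
  rw [h3, Matrix.mulVec_add, Matrix.mulVec_mulVec, Matrix.mulVec_mulVec]
  congr 2
  ext j k
  rw [Matrix.mul_apply, signedGram, Matrix.of_apply]
  refine Finset.sum_congr rfl fun t _ => ?_
  rw [Matrix.mul_diagonal, Matrix.transpose_apply]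
  ring

/-- A matrix is bounded by its Frobenius norm. -/
theorem norm_sq_mulVec_le (G : Matrix (Fin d) (Fin d) ℝ) (u : Fin d → ℝ) :
    ‖WithLp.toLp 2 (G *ᵥ u)‖ ^ 2 ≤ (∑ j, ∑ k, G j k ^ 2) * ‖WithLp.toLp 2 u‖ ^ 2 := by
  rw [EuclideanSpace.real_norm_sq_eq, EuclideanSpace.real_norm_sq_eq, Finset.sum_mul]
  exact Finset.sum_le_sum fun j _ => Finset.sum_mul_sq_le_sq_mul_sq Finset.univ (G j) u

/-- If `‖b‖ ≤ ‖u‖ / 2`, then `‖u + g‖ ≤ ‖b + g'‖` forces `‖u‖ ≤ 2 (‖g‖ + ‖g'‖)`. -/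
theorem norm_sq_le_of_norm_add_le {E : Type*} [SeminormedAddCommGroup E] {u g b g' : E} {R : ℝ}
    (h : ‖u + g‖ ≤ ‖b + g'‖) (hb : ‖b‖ ^ 2 ≤ 1 / 4 * ‖u‖ ^ 2)
    (hg : ‖g‖ ^ 2 + ‖g'‖ ^ 2 ≤ R) : ‖u‖ ^ 2 ≤ 8 * R := by
  have hb' : ‖b‖ ≤ 1 / 2 * ‖u‖ := abs_le_of_sq_le_sq' (by linarith) (by positivity) |>.2
  have h1 : ‖u‖ ≤ ‖u + g‖ + ‖g‖ := by simpa using norm_sub_le (u + g) g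
  have h2 := norm_add_le b g'
  nlinarith [sq_nonneg (‖g‖ - ‖g'‖), norm_nonneg u, norm_nonneg g, norm_nonneg g']

theorem exists_norm_S_le_of_mem_confRegion {m q : ℕ} [NeZero m] (hq : 0 < q) (hqm : q < m)
    {y : ℕ → ℝ} {a : {i : Fin m // i ≠ 0} → Fin n → ℝ} {π : Equiv.Perm (Fin m)}
    {θ : EuclideanSpace ℝ (Fin d)} (h : θ ∈ confRegion q φ y a π) :
    ∃ i : {i : Fin m // i ≠ 0}, ‖signSum φ y n (fun _ => 1) θ‖ ≤ ‖signSum φ y n (a i) θ‖ := by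
  by_contra! hlt
  have hr : rank φ y a π θ ≤ m - q := by
    by_contra hr
    simp [confRegion, indicator, hr] at h
  have hT : ∀ i : {i : Fin m // i ≠ 0}, TieGT φ y a π θ 0 i := fun i => by
    left
    have hi : (i : Fin m) ≠ 0 := i.2
    simp only [S, dif_pos, hi, dif_neg, not_false_eq_true]
    exact pow_lt_pow_left₀ (hlt i) (norm_nonneg _) two_ne_zero
  -- All `m - 1` perturbed sums would be dominated, and the rank would be `m > m - q`.
  have hc : Fintype.card {i : Fin m // i ≠ 0} = m - 1 := by
    simp [Fintype.card_subtype_compl]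
  simp only [rank, hT, if_true, Finset.sum_const, Finset.card_univ, hc, smul_eq_mul,
    mul_one] at hr
  omega

/-- If every signed quadratic form is small and every noise term is bounded, the confidence
region lies in a ball around the true parameter. -/
theorem norm_sub_sq_le_of_mem_confRegion (hn : 0 < n) {l : ℝ} (hl0 : 0 < l)
    (hl : l ≤ lambdaMin (Rbar_isHermitian φ n)) {m q : ℕ} [NeZero m] (hq : 0 < q) (hqm : q < m)
    {θs θ : EuclideanSpace ℝ (Fin d)} {w : ℕ → ℝ} {a : {i : Fin m // i ≠ 0} → Fin n → ℝ}
    {π : Equiv.Perm (Fin m)} {R : ℝ}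
    (hG : ∀ i, ∑ j, ∑ k, signedGram (whitened φ n) (a i) j k ^ 2 ≤ 1 / 4)
    (hg : ∀ i, ‖WithLp.toLp 2 ((whitened φ n)ᵀ *ᵥ fun t => w t)‖ ^ 2 +
      ‖WithLp.toLp 2 ((whitened φ n)ᵀ *ᵥ fun t => a i t * w t)‖ ^ 2 ≤ R)
    (h : θ ∈ confRegion q φ (output φ θs w) a π) :
    n * l * ‖θs - θ‖ ^ 2 ≤ 8 * R := by
  have hP := posDef_of_lambdaMin_pos _ (hl0.trans_le hl)
  obtain ⟨i, hi⟩ := exists_norm_S_le_of_mem_confRegion hq hqm h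
  have h1 := mul_le_mul_of_nonneg_left hi (norm_nonneg √(n : ℝ))
  rw [← norm_smul, ← norm_smul, sqrt_smul_signSum hn hP, sqrt_smul_signSum hn hP,
    signedGram_one (transpose_mul_whitened hn hP), Matrix.one_mulVec] at h1
  simp only [one_mul] at h1
  have h2 := norm_sq_le_of_norm_add_le h1
    ((norm_sq_mulVec_le _ _).trans (mul_le_mul_of_nonneg_right (hG i) (by positivity))) (hg i)
  refine le_trans ?_ h2
  have h3 : ∀ x : Fin d → ℝ, ‖WithLp.toLp 2 x‖ ^ 2 = x ⬝ᵥ x := fun x => by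
    rw [EuclideanSpace.real_norm_sq_eq]
    simp [dotProduct, pow_two]
  have h4 := mul_dotProduct_le_whitenedError hn hP hl (WithLp.ofLp (θs - θ))
  rw [← h3, ← h3] at h4
  exact h4

end Deterministic

/-! ### Second moments of noise and signs -/

theorem integral_mul_eq_of_indep {Ω : Type*} {m₁ m₂ mΩ : MeasurableSpace Ω} {P : Measure Ω}
    (hm : Indep m₁ m₂ P) (hm₁ : m₁ ≤ mΩ) (hm₂ : m₂ ≤ mΩ) {f g : Ω → ℝ}
    (hf : Measurable[m₁] f) (hg : Measurable[m₂] g) :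
    ∫ ω, f ω * g ω ∂P = (∫ ω, f ω ∂P) * ∫ ω, g ω ∂P := by
  have hfg : IndepFun f g P := by
    rw [IndepFun_iff_Indep]
    exact indep_of_indep_of_le hm hf.comap_le hg.comap_le
  exact hfg.integral_fun_mul_eq_mul_integral (hf.mono hm₁ le_rfl).aestronglyMeasurable
    (hg.mono hm₂ le_rfl).aestronglyMeasurable

section Moments

variable {Ω : Type*} [MeasurableSpace Ω] {P : Measure Ω}

/-- A finite family in `L²` that is orthogonal, with all second moments at most `v`. -/
structure OrthogonalFamily {n : ℕ} (P : Measure Ω) (X : Fin n → Ω → ℝ) (v : ℝ) : Prop where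
  memLp : ∀ t, MemLp (X t) 2 P
  orthogonal : ∀ s t, s ≠ t → ∫ ω, X s ω * X t ω ∂P = 0
  integral_sq_le : ∀ t, ∫ ω, X t ω ^ 2 ∂P ≤ v

namespace OrthogonalFamily

variable {d n : ℕ} {X : Fin n → Ω → ℝ} {v : ℝ}

theorem integrable_sq_sum (h : OrthogonalFamily P X v) (c : Fin n → ℝ) :
    Integrable (fun ω => (∑ t, X t ω * c t) ^ 2) P := by
  have : MemLp (fun ω => ∑ t, X t ω * c t) 2 P :=
    memLp_finsetSum _ fun t _ => (h.memLp t).mul_const (c t)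
  exact this.integrable_sq

theorem integral_sq_sum_le (h : OrthogonalFamily P X v) (c : Fin n → ℝ) :
    ∫ ω, (∑ t, X t ω * c t) ^ 2 ∂P ≤ v * ∑ t, c t ^ 2 := by
  have hi : ∀ s t, Integrable (fun ω => X s ω * X t ω) P := fun s t =>
    (h.memLp s).integrable_mul (h.memLp t)
  have h1 : ∀ ω, (∑ t, X t ω * c t) ^ 2 = ∑ s, ∑ t, c s * c t * (X s ω * X t ω) := fun ω => by
    rw [pow_two, Finset.sum_mul_sum]
    exact Finset.sum_congr rfl fun s _ => Finset.sum_congr rfl fun t _ => by ring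
  simp_rw [h1]
  rw [integral_finsetSum _ fun s _ => integrable_finsetSum _ fun t _ => (hi s t).const_mul _,
    Finset.mul_sum]
  refine Finset.sum_le_sum fun s _ => ?_
  rw [integral_finsetSum _ fun t _ => (hi s t).const_mul _]
  simp_rw [integral_const_mul]
  rw [Finset.sum_eq_single s (fun t _ hts => by rw [h.orthogonal s t hts.symm, mul_zero])
    (by simp)]
  have := h.integral_sq_le s
  simp_rw [← pow_two]
  rw [mul_comm v]
  exact mul_le_mul_of_nonneg_left this (sq_nonneg _)

theorem integrable_norm_sq (h : OrthogonalFamily P X v) (V : Matrix (Fin n) (Fin d) ℝ) :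
    Integrable (fun ω => ‖WithLp.toLp 2 (Vᵀ *ᵥ fun t => X t ω)‖ ^ 2) P := by
  simp only [EuclideanSpace.real_norm_sq_eq, Matrix.mulVec, dotProduct, Matrix.transpose_apply,
    mul_comm (V _ _)]
  exact integrable_finsetSum _ fun j _ => h.integrable_sq_sum _

theorem integral_norm_sq_le (h : OrthogonalFamily P X v) (V : Matrix (Fin n) (Fin d) ℝ) :
    ∫ ω, ‖WithLp.toLp 2 (Vᵀ *ᵥ fun t => X t ω)‖ ^ 2 ∂P ≤ v * ∑ j, ∑ t, V t j ^ 2 := by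
  simp only [EuclideanSpace.real_norm_sq_eq, Matrix.mulVec, dotProduct, Matrix.transpose_apply,
    mul_comm (V _ _)]
  rw [integral_finsetSum _ fun j _ => h.integrable_sq_sum _, Finset.mul_sum]
  exact Finset.sum_le_sum fun j _ => h.integral_sq_sum_le _

theorem integrable_signedGram (h : OrthogonalFamily P X v) (V : Matrix (Fin n) (Fin d) ℝ) :
    Integrable (fun ω => ∑ j, ∑ k, signedGram V (fun t => X t ω) j k ^ 2) P :=
  integrable_finsetSum _ fun _ _ => integrable_finsetSum _ fun _ _ => h.integrable_sq_sum _

/-- The mean square of the Frobenius norm of `Vᵀ diag(X) V` is at most the sum of the fourth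
powers of the row norms of `V`, hence small when `V` is incoherent. -/
theorem integral_signedGram_le (h : OrthogonalFamily P X 1) (V : Matrix (Fin n) (Fin d) ℝ)
    {ε : ℝ} (hV : ∀ t, ∑ j, V t j ^ 2 ≤ ε) :
    ∫ ω, ∑ j, ∑ k, signedGram V (fun t => X t ω) j k ^ 2 ∂P ≤ ε * ∑ j, ∑ t, V t j ^ 2 := by
  calc ∫ ω, ∑ j, ∑ k, signedGram V (fun t => X t ω) j k ^ 2 ∂P
      = ∑ j, ∑ k, ∫ ω, (∑ t, X t ω * (V t j * V t k)) ^ 2 ∂P := by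
        simp only [signedGram, Matrix.of_apply]
        rw [integral_finsetSum _ fun _ _ => integrable_finsetSum _ fun _ _ =>
          h.integrable_sq_sum _]
        exact Finset.sum_congr rfl fun j _ =>
          integral_finsetSum _ fun _ _ => h.integrable_sq_sum _
    _ ≤ ∑ j, ∑ k, ∑ t, (V t j * V t k) ^ 2 := Finset.sum_le_sum fun j _ =>
        Finset.sum_le_sum fun k _ => (h.integral_sq_sum_le _).trans_eq (one_mul _)
    _ = ∑ j, ∑ t, V t j ^ 2 * ∑ k, V t k ^ 2 := by
        refine Finset.sum_congr rfl fun j _ => ?_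
        rw [Finset.sum_comm]
        refine Finset.sum_congr rfl fun t _ => ?_
        rw [Finset.mul_sum]
        exact Finset.sum_congr rfl fun k _ => mul_pow _ _ _
    _ ≤ ε * ∑ j, ∑ t, V t j ^ 2 := by
        simp_rw [Finset.mul_sum]
        refine Finset.sum_le_sum fun j _ => Finset.sum_le_sum fun t _ => ?_
        rw [← Finset.mul_sum, mul_comm]
        exact mul_le_mul_of_nonneg_right (hV t) (sq_nonneg _)

end OrthogonalFamily

theorem integral_eq_zero_of_map_neg {X : Ω → ℝ} (hX : Measurable X)
    (h : P.map (fun ω => -X ω) = P.map X) : ∫ ω, X ω ∂P = 0 := by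
  have h1 : ∫ ω, X ω ∂P = ∫ x, x ∂(P.map X) :=
    (integral_map hX.aemeasurable aestronglyMeasurable_id).symm
  have h2 : ∫ ω, -X ω ∂P = ∫ x, x ∂(P.map fun ω => -X ω) :=
    (integral_map hX.neg.aemeasurable aestronglyMeasurable_id).symm
  rw [h, ← h1, integral_neg] at h2
  linarith

variable [IsProbabilityMeasure P]

theorem sq_le_exp_add_exp_neg (s : ℝ) : s ^ 2 ≤ 2 * (Real.exp s + Real.exp (-s) - 2) := by
  rcases le_total 0 s with hs | hs
  · linarith [Real.quadratic_le_exp_of_nonneg hs, Real.add_one_le_exp (-s)]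
  · have := Real.quadratic_le_exp_of_nonneg (neg_nonneg.2 hs)
    rw [neg_sq] at this
    linarith [Real.add_one_le_exp s]

/-- The sharp constant is `1`; the factor `4` comes from testing the moment generating function at
`± σ⁻¹` only. -/
theorem integral_sq_le_of_hasSubgaussianMGF {X : Ω → ℝ} {σ : ℝ≥0} (hσ : 0 < σ)
    (h : HasSubgaussianMGF X (σ ^ 2) P) : ∫ ω, X ω ^ 2 ∂P ≤ 4 * (σ : ℝ) ^ 2 := by
  have hσ' : (0 : ℝ) < σ := by exact_mod_cast hσ
  -- The moment generating function at `± σ⁻¹` is at most `exp (1 / 2) < 2`.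
  have hm : ∀ t : ℝ, t ^ 2 = ((σ : ℝ)⁻¹) ^ 2 → ∫ ω, Real.exp (t * X ω) ∂P ≤ 2 := fun t ht => by
    refine (h.mgf_le t).trans ?_
    have h1 : ((σ ^ 2 : ℝ≥0) : ℝ) * t ^ 2 / 2 = 1 / 2 := by
      rw [ht]
      push_cast
      field_simp
    rw [h1]
    have h2 : Real.exp (1 / 2) ^ 2 = Real.exp 1 := by
      rw [← Real.exp_nat_mul]
      norm_num
    nlinarith [Real.exp_one_lt_d9, Real.exp_pos (1 / 2)]
  have h1 := hm _ rfl
  have h2 := hm (-(σ : ℝ)⁻¹) (neg_sq _)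
  have i1 := h.integrable_exp_mul (σ : ℝ)⁻¹
  have i2 := h.integrable_exp_mul (-(σ : ℝ)⁻¹)
  have h3 : ∫ ω, ((σ : ℝ)⁻¹ * X ω) ^ 2 ∂P ≤
      ∫ ω, 2 * (Real.exp ((σ : ℝ)⁻¹ * X ω) + Real.exp (-(σ : ℝ)⁻¹ * X ω) - 2) ∂P := by
    refine integral_mono_of_nonneg (ae_of_all _ fun ω => sq_nonneg _)
      (((i1.add i2).sub (integrable_const 2)).const_mul 2) (ae_of_all _ fun ω => ?_)
    simpa using sq_le_exp_add_exp_neg ((σ : ℝ)⁻¹ * X ω)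
  have i3 : Integrable (fun ω => Real.exp ((σ : ℝ)⁻¹ * X ω) + Real.exp (-(σ : ℝ)⁻¹ * X ω)) P :=
    i1.add i2
  rw [integral_const_mul, integral_sub i3 (integrable_const _), integral_add i1 i2] at h3
  simp only [mul_pow, integral_const_mul, integral_const, probReal_univ, one_smul] at h3
  have h4 : ((σ : ℝ)⁻¹) ^ 2 * ∫ ω, X ω ^ 2 ∂P ≤ 4 := by linarith
  rwa [inv_pow, inv_mul_le_iff₀ (by positivity), mul_comm] at h4

theorem sign_moments {a : Ω → ℝ} (ha : Measurable a) (h1 : P {ω | a ω = 1} = 1 / 2)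
    (h2 : P {ω | a ω = -1} = 1 / 2) : (∀ᵐ ω ∂P, a ω ^ 2 = 1) ∧ ∫ ω, a ω ∂P = 0 := by
  have m1 : MeasurableSet {ω | a ω = 1} := ha (measurableSet_singleton 1)
  have m2 : MeasurableSet {ω | a ω = -1} := ha (measurableSet_singleton (-1))
  have hd : Disjoint {ω | a ω = 1} {ω | a ω = -1} := by
    rw [Set.disjoint_left]
    intro ω h h'
    simp only [Set.mem_ofPred_eq] at h h'
    linarith
  have hu : ∀ᵐ ω ∂P, ω ∈ {ω | a ω = 1} ∪ {ω | a ω = -1} := by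
    change _ ∈ ae P
    rw [Set.ofPred_mem_eq, mem_ae_iff_prob_eq_one (m1.union m2), measure_union hd m2, h1, h2]
    exact ENNReal.add_halves 1
  refine ⟨hu.mono fun ω h => ?_, ?_⟩
  · rcases h with h | h <;> rw [h] <;> norm_num
  · have : a =ᵐ[P] fun ω => {ω | a ω = 1}.indicator (1 : Ω → ℝ) ω -
        {ω | a ω = -1}.indicator (1 : Ω → ℝ) ω := by
      refine hu.mono fun ω h => ?_
      rcases h with h | h <;> simp only [Set.mem_ofPred_eq] at h <;>
        simp [Set.indicator, h] <;> norm_num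
    have hi : ∀ {A : Set Ω}, MeasurableSet A → Integrable (A.indicator (1 : Ω → ℝ)) P :=
      fun hA => (integrable_const (1 : ℝ)).indicator hA
    rw [integral_congr_ae this, integral_sub (hi m1) (hi m2), integral_indicator_one m1,
      integral_indicator_one m2, measureReal_def, measureReal_def, h1, h2, sub_self]

theorem memLp_two_of_sq_eq_one {a : Ω → ℝ} (ha : Measurable a) (h : ∀ᵐ ω ∂P, a ω ^ 2 = 1) :
    MemLp a 2 P :=
  MemLp.of_bound ha.aestronglyMeasurable 1 (h.mono fun ω hω => by
    rw [Real.norm_eq_abs, ← sq_le_sq₀ (abs_nonneg _) zero_le_one, sq_abs, hω, one_pow])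

/-- A `0`-subgaussian variable vanishes almost surely, so it has an atom. -/
theorem NoiseAssumption.pos {W : ℕ → Ω → ℝ} {σ : ℝ≥0} (h : NoiseAssumption P W σ) : 0 < σ := by
  rw [pos_iff_ne_zero]
  rintro rfl
  have h0 : W 0 =ᵐ[P] 0 :=
    HasSubgaussianMGF.ae_eq_zero_of_hasSubgaussianMGF_zero (by simpa using h.subgaussian 0)
  have h1 : ∀ᵐ ω ∂P, W 0 ω ≠ 0 := by
    rw [ae_iff]
    simpa using h.nonatomic 0 0
  obtain ⟨ω, hω, hω'⟩ := (h0.and h1).exists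
  exact hω' hω

theorem NoiseAssumption.orthogonalFamily {W : ℕ → Ω → ℝ} {σ : ℝ≥0} (h : NoiseAssumption P W σ)
    (n : ℕ) : OrthogonalFamily P (fun t : Fin n => W t) (4 * (σ : ℝ) ^ 2) where
  memLp t := by simpa using (h.subgaussian t).memLp 2
  orthogonal s t hst := by
    rw [(h.indep.indepFun (Fin.val_injective.ne hst)).integral_fun_mul_eq_mul_integral
      (h.measurable s).aestronglyMeasurable (h.measurable t).aestronglyMeasurable,
      integral_eq_zero_of_map_neg (h.measurable s) (h.symmetric s), zero_mul]
  integral_sq_le t := integral_sq_le_of_hasSubgaussianMGF h.pos (h.subgaussian t)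

variable {m n : ℕ} [NeZero m] {W : ℕ → Ω → ℝ} {α : {i : Fin m // i ≠ 0} → Fin n → Ω → ℝ}
  {π : Ω → Equiv.Perm (Fin m)}

theorem Randomization.orthogonalFamily (h : Randomization P W α π) (i : {i : Fin m // i ≠ 0}) :
    OrthogonalFamily P (α i) 1 where
  memLp t := memLp_two_of_sq_eq_one (h.measurable_sign i t)
    (sign_moments (h.measurable_sign i t) (h.sign_pos i t) (h.sign_neg i t)).1
  orthogonal s t hst := by
    have hne : ((i, s) : {i : Fin m // i ≠ 0} × Fin n) ≠ (i, t) := fun he =>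
      hst (congrArg Prod.snd he)
    rw [(h.indep_sign.indepFun hne).integral_fun_mul_eq_mul_integral
      (h.measurable_sign i s).aestronglyMeasurable (h.measurable_sign i t).aestronglyMeasurable,
      (sign_moments (h.measurable_sign i s) (h.sign_pos i s) (h.sign_neg i s)).2, zero_mul]
  integral_sq_le t := by
    rw [integral_congr_ae
      (sign_moments (h.measurable_sign i t) (h.sign_pos i t) (h.sign_neg i t)).1]
    simp

/-- Signs independent of the noise preserve its second moments and its orthogonality:
`𝔼 (α_s W_s) (α_t W_t) = 𝔼 (α_s α_t) 𝔼 (W_s W_t)`. -/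
theorem Randomization.orthogonalFamily_mul {σ : ℝ≥0} (h : Randomization P W α π)
    (hW : NoiseAssumption P W σ) (i : {i : Fin m // i ≠ 0}) :
    OrthogonalFamily P (fun t ω => α i t ω * W t ω) (4 * (σ : ℝ) ^ 2) where
  memLp t := by
    refine (hW.orthogonalFamily n).memLp t |>.of_le
      ((h.measurable_sign i t).mul (hW.measurable t)).aestronglyMeasurable ?_
    refine (sign_moments (h.measurable_sign i t) (h.sign_pos i t) (h.sign_neg i t)).1.mono
      fun ω hω => ?_
    rw [← sq_le_sq₀ (norm_nonneg _) (norm_nonneg _)]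
    simp only [Real.norm_eq_abs, sq_abs, mul_pow, hω, one_mul, le_refl]
  orthogonal s t hst := by
    have hind : Indep (⨆ i, ⨆ t, MeasurableSpace.comap (α i t) inferInstance)
        (⨆ t, MeasurableSpace.comap (W t) inferInstance) P :=
      h.indep.indep (i := 1) (j := 0) (by decide)
    have hα : ∀ t, Measurable[⨆ i, ⨆ t, MeasurableSpace.comap (α i t) inferInstance] (α i t) :=
      fun t => (comap_measurable (α i t)).mono
        (le_iSup_of_le i (le_iSup (fun t => MeasurableSpace.comap (α i t) _) t)) le_rfl
    have hWm : ∀ t, Measurable[⨆ t, MeasurableSpace.comap (W t) inferInstance] (W t) :=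
      fun t => (comap_measurable (W t)).mono
        (le_iSup (fun t => MeasurableSpace.comap (W t) _) t) le_rfl
    have := integral_mul_eq_of_indep hind
      (iSup_le fun i => iSup_le fun t => (h.measurable_sign i t).comap_le)
      (iSup_le fun t => (hW.measurable t).comap_le)
      (@Measurable.mul _ _ _ _ _ (_) _ _ (hα s) (hα t))
      (@Measurable.mul _ _ _ _ _ (_) _ _ (hWm s) (hWm t))
    simp only [Pi.mul_apply] at this
    rw [(h.orthogonalFamily i).orthogonal s t hst, zero_mul] at this
    rw [← this]
    exact integral_congr_ae (ae_of_all _ fun ω => by ring)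
  integral_sq_le t := by
    refine le_trans (le_of_eq (integral_congr_ae ?_)) ((hW.orthogonalFamily n).integral_sq_le t)
    refine (sign_moments (h.measurable_sign i t) (h.sign_pos i t) (h.sign_neg i t)).1.mono
      fun ω hω => ?_
    simp only [mul_pow, hω, one_mul]

end Moments

/-! ### The diameter bound -/

/-- With `Z = ∑ i, (4 ‖Vᵀ D_i V‖² + (‖Vᵀ W‖² + ‖Vᵀ D_i W‖²) / R)`, every bad event is contained in
`{1 ≤ Z}`, and Markov's inequality applies to `Z`. -/
theorem measure_lt_ediam_confRegion_le {d n m q : ℕ} [NeZero m] (hd : 0 < d) (hn : 0 < n)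
    (hdn : d ≤ n) (hq : 0 < q) (hqm : q < m) {κ ρ δ lam0 : ℝ} {σ : ℝ≥0} (hδ : 0 < δ)
    (hl : 0 < lam0) (hκ : m * (4 * (d * κ * (n : ℝ) ^ (-ρ) * d)) ≤ δ / 2)
    {Ω : Type*} [MeasurableSpace Ω] {P : Measure Ω} [IsProbabilityMeasure P]
    {W : ℕ → Ω → ℝ} {φ : ℕ → EuclideanSpace ℝ (Fin d)} (θs : EuclideanSpace ℝ (Fin d))
    (hW : NoiseAssumption P W σ) (hφ : NonvanishingExcitation φ lam0)
    (hμ : CoherenceBound φ κ ρ) {α : {i : Fin m // i ≠ 0} → Fin n → Ω → ℝ}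
    {π : Ω → Equiv.Perm (Fin m)} (hα : Randomization P W α π) :
    P {ω | ENNReal.ofReal (2 * √(128 * m * d / δ) * σ / √lam0 / √n) <
      Metric.ediam (confRegion q φ (output φ θs fun t => W t ω)
        (fun i t => α i t ω) (π ω))} ≤ ENNReal.ofReal δ := by
  have hm : (0 : ℝ) < m := by exact_mod_cast hq.trans hqm
  have hd' : (0 : ℝ) < d := by exact_mod_cast hd
  have hn' : (0 : ℝ) < n := by exact_mod_cast hn
  have hσ : (0 : ℝ) < σ := by exact_mod_cast hW.pos
  have hlam := hφ n hdn
  have hP := posDef_of_lambdaMin_pos _ (hl.trans_le hlam)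
  set V := whitened φ n
  have hVd : ∑ j, ∑ t, V t j ^ 2 = d := sum_sum_sq_whitened hn hP
  have hVε := sum_sq_whitened_le hd hn hP (hμ n hdn)
  set ε := d * κ * (n : ℝ) ^ (-ρ)
  -- With this `R` the noise terms contribute at most `m (8 σ² d / R) = δ / 2` to the mean of `Z`.
  set R : ℝ := 16 * m * d * σ ^ 2 / δ with hR
  have hR0 : 0 < R := by positivity
  set F : {i : Fin m // i ≠ 0} → Ω → ℝ := fun i ω =>
    ∑ j, ∑ k, signedGram V (fun t => α i t ω) j k ^ 2
  set g₀ : Ω → ℝ := fun ω => ‖WithLp.toLp 2 (Vᵀ *ᵥ fun t : Fin n => W t ω)‖ ^ 2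
  set g : {i : Fin m // i ≠ 0} → Ω → ℝ := fun i ω =>
    ‖WithLp.toLp 2 (Vᵀ *ᵥ fun t => α i t ω * W t ω)‖ ^ 2
  set Z : Ω → ℝ := fun ω => ∑ i, (4 * F i ω + (g₀ ω + g i ω) / R)
  have hF0 : ∀ i ω, 0 ≤ F i ω := fun i ω =>
    Finset.sum_nonneg fun _ _ => Finset.sum_nonneg fun _ _ => sq_nonneg _
  have hg0 : ∀ ω, 0 ≤ g₀ ω := fun ω => sq_nonneg _
  have hgi0 : ∀ i ω, 0 ≤ g i ω := fun i ω => sq_nonneg _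
  have hZi0 : ∀ i ω, 0 ≤ 4 * F i ω + (g₀ ω + g i ω) / R := fun i ω =>
    add_nonneg (mul_nonneg zero_le_four (hF0 i ω))
      (div_nonneg (add_nonneg (hg0 ω) (hgi0 i ω)) hR0.le)
  have iF : ∀ i, Integrable (F i) P := fun i => (hα.orthogonalFamily i).integrable_signedGram V
  have ig : Integrable g₀ P := (hW.orthogonalFamily n).integrable_norm_sq V
  have igi : ∀ i, Integrable (g i) P := fun i =>
    (hα.orthogonalFamily_mul hW i).integrable_norm_sq V
  have iS : ∀ i, Integrable (fun ω => (g₀ ω + g i ω) / R) P := fun i =>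
    (ig.add (igi i)).div_const R
  have iZi : ∀ i, Integrable (fun ω => 4 * F i ω + (g₀ ω + g i ω) / R) P := fun i =>
    ((iF i).const_mul 4).add (iS i)
  have hEi : ∀ i, ∫ ω, (4 * F i ω + (g₀ ω + g i ω) / R) ∂P ≤
      4 * (ε * d) + 8 * σ ^ 2 * d / R := fun i => by
    rw [integral_add ((iF i).const_mul 4) (iS i), integral_const_mul, integral_div,
      integral_add ig (igi i)]
    have h1 := (hα.orthogonalFamily i).integral_signedGram_le V hVε
    have h2 := (hW.orthogonalFamily n).integral_norm_sq_le V
    have h3 := (hα.orthogonalFamily_mul hW i).integral_norm_sq_le V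
    rw [hVd] at h1 h2 h3
    refine add_le_add (mul_le_mul_of_nonneg_left h1 zero_le_four)
      (div_le_div_of_nonneg_right ?_ hR0.le)
    linarith
  have hEZ : ∫ ω, Z ω ∂P ≤ δ := by
    have hc : ((Fintype.card {i : Fin m // i ≠ 0} : ℕ) : ℝ) ≤ m := by
      exact_mod_cast (Fintype.card_subtype_le _).trans_eq (Fintype.card_fin m)
    have hb : 0 ≤ 4 * (ε * d) + 8 * σ ^ 2 * d / R := by
      have : (0 : ℝ) ≤ ε := (Finset.sum_nonneg fun _ _ => sq_nonneg _).trans (hVε ⟨0, hn⟩)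
      positivity
    have hRd : m * (8 * σ ^ 2 * d / R) = δ / 2 := by
      rw [hR]
      field_simp
      norm_num
    calc ∫ ω, Z ω ∂P = ∑ i, ∫ ω, (4 * F i ω + (g₀ ω + g i ω) / R) ∂P :=
          integral_finsetSum _ fun i _ => iZi i
      _ ≤ ∑ _i : {i : Fin m // i ≠ 0}, (4 * (ε * d) + 8 * σ ^ 2 * d / R) :=
          Finset.sum_le_sum fun i _ => hEi i
      _ ≤ m * (4 * (ε * d) + 8 * σ ^ 2 * d / R) := by
          rw [Finset.sum_const, Finset.card_univ, nsmul_eq_mul]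
          exact mul_le_mul_of_nonneg_right hc hb
      _ ≤ δ := by
          rw [mul_add, hRd]
          linarith
  have hmarkov : P.real {ω | 1 ≤ Z ω} ≤ δ := by
    have := mul_meas_ge_le_integral_of_nonneg
      (ae_of_all P fun ω => Finset.sum_nonneg fun i _ => hZi0 i ω)
      (integrable_finsetSum Finset.univ fun i _ => iZi i) 1
    rw [one_mul] at this
    exact this.trans hEZ
  refine (measure_mono ?_).trans ((ENNReal.le_ofReal_iff_toReal_le (measure_ne_top _ _)
    hδ.le).2 hmarkov)
  intro ω hω
  by_contra hZ
  rw [Set.mem_ofPred_eq, not_le] at hZ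
  rw [Set.mem_ofPred_eq] at hω
  refine hω.not_ge ?_
  have hi : ∀ i, 4 * F i ω + (g₀ ω + g i ω) / R < 1 := fun i =>
    (Finset.single_le_sum (f := fun i => 4 * F i ω + (g₀ ω + g i ω) / R)
      (fun i _ => hZi0 i ω) (Finset.mem_univ i)).trans_lt hZ
  have hF : ∀ i, F i ω ≤ 1 / 4 := fun i => by
    have := div_nonneg (add_nonneg (hg0 ω) (hgi0 i ω)) hR0.le
    linarith [hi i]
  have hgR : ∀ i, g₀ ω + g i ω ≤ R := fun i => by
    rw [← div_le_one hR0]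
    linarith [hi i, hF0 i ω]
  have hball : ∀ θ ∈ confRegion q φ (output φ θs fun t => W t ω) (fun i t => α i t ω) (π ω),
      dist θ θs ≤ √(128 * m * d / δ) * σ / √lam0 / √n := fun θ hθ => by
    have h1 := norm_sub_sq_le_of_mem_confRegion hn hl hlam hq hqm
      (w := fun t => W t ω) (a := fun i t => α i t ω) hF hgR hθ
    have h2 : 8 * R = 128 * m * d / δ * σ ^ 2 := by
      rw [hR]
      ring
    rw [dist_comm, dist_eq_norm, div_div, ← Real.sqrt_mul hl.le,
      le_div_iff₀ (Real.sqrt_pos.2 (mul_pos hl hn'))]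
    refine abs_le_of_sq_le_sq' ?_ (by positivity) |>.2
    rw [mul_pow, mul_pow, Real.sq_sqrt (by positivity), Real.sq_sqrt (by positivity)]
    linarith
  refine Metric.ediam_le fun x hx y hy => ?_
  rw [edist_dist]
  refine ENNReal.ofReal_le_ofReal ?_
  have := dist_triangle_right x y θs
  calc dist x y ≤ dist x θs + dist y θs := this
    _ ≤ _ := add_le_add (hball x hx) (hball y hy)
    _ = _ := by ring

end SPS

theorem corollary1 (d : ℕ) (hd : 0 < d) (m q : ℕ) [NeZero m] (hq : 0 < q) (hqm : q < m)
    (δ : ℝ) (hδ : 0 < δ) :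
    ∃ c : ℝ, 0 < c ∧
      ∀ κ ρ : ℝ, 0 < κ → 0 < ρ → ρ ≤ 1 →
        ∃ N : ℕ, 0 < N ∧
          ∀ (σ : ℝ≥0) (lam0 : ℝ), 0 < lam0 →
          ∀ {Ω : Type*} [MeasurableSpace Ω] (P : Measure Ω) [IsProbabilityMeasure P]
            (W : ℕ → Ω → ℝ) (φ : ℕ → EuclideanSpace ℝ (Fin d)) (θs : EuclideanSpace ℝ (Fin d)),
            SPS.NoiseAssumption P W σ →
            SPS.CompletelyExciting φ →
            SPS.NonvanishingExcitation φ lam0 →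
            SPS.CoherenceBound φ κ ρ →
            ∀ n : ℕ, N ≤ n →
            ∀ (α : {i : Fin m // i ≠ 0} → Fin n → Ω → ℝ) (π : Ω → Equiv.Perm (Fin m)),
              SPS.Randomization P W α π →
              P {ω | ENNReal.ofReal (c * σ / √lam0 / √n) <
                Metric.ediam (SPS.confRegion q φ (SPS.output φ θs fun t => W t ω)
                  (fun i t => α i t ω) (π ω))} ≤ ENNReal.ofReal δ := by
  have hm : (0 : ℝ) < m := by exact_mod_cast hq.trans hqm
  have hd' : (0 : ℝ) < d := by exact_mod_cast hd
  refine ⟨2 * √(128 * m * d / δ), by positivity, fun κ ρ hκ hρ _ => ?_⟩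
  have hlim : Filter.Tendsto (fun n : ℕ => m * (4 * (d * κ * (n : ℝ) ^ (-ρ) * d)))
      Filter.atTop (nhds 0) := by
    have := ((((tendsto_rpow_neg_atTop hρ).comp tendsto_natCast_atTop_atTop).const_mul
      (d * κ)).mul_const (d : ℝ)).const_mul 4 |>.const_mul (m : ℝ)
    simpa using this
  obtain ⟨N, hN⟩ := Filter.eventually_atTop.1 (hlim.eventually_le_const (half_pos hδ))
  refine ⟨max N d, lt_max_of_lt_right hd, ?_⟩
  intro σ lam0 hl Ω _ P _ W φ θs hW _ hφ hμ n hn α π hα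
  have hdn : d ≤ n := (le_max_right N d).trans hn
  exact SPS.measure_lt_ediam_confRegion_le hd (hd.trans_le hdn) hdn hq hqm hδ hl
    (hN n ((le_max_left N d).trans hn)) θs hW hφ hμ hα
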